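/- **Setting.** Let $G=(V,E)$ be a finite simple connected graph, $n=|V|$. For $u,v\in V$ let $I(u,v)$ be the set of nodes that lie on some shortest $u$-$v$ path. A set $C\subseteq V$ is convex if $I(a,b)\subseteq C$ for all $a,b\in C$. A convex bipartition of $G$ is a labeling $y:V\to\{0,1\}$ such that both $y^{-1}(0)$ and $y^{-1}(1)$ are convex (one of them may be empty); let $\mathcal H$ be the set of convex bipartitions. In self-directed learning, in each of $n$ trials the learner selects a node not selected before, predicts its label, and then observes its true label; a trial is a mistake if the prediction is wrong. $\mathrm{M}_{\mathrm{sd}}(A,\mathcal H)$ is the maximum, over $y\in\mathcal H$, of the number of mistakes of the learner $A$ on $y$. A good quadruple in $U\subseteq V$ is an unordered pair $\{(a,b),(c,d)\}$ of unordered pairs, where $a,b,c,d\in U$ are distinct and $I(a,b)\cap I(c,d)\neq\emptyset$; the set of these is $Q_{\mathrm{good}}(U)$. **Good4.** Let $U$ be the set of nodes not yet labeled (every selected node leaves $U$); initially $U=V$. While $Q_{\mathrm{good}}(U)\ne\emptyset$, repeat Steps 1 to 4: 1. Select a node $a\in U$ contained in the maximum number of good quadruples in $U$, predict arbitrarily,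 observe $\tilde y=y(a)$. 2. Fix $W=U\cup\{a\}$. Repeatedly select the $b\in U$ that maximizes the number of pairs $(c,d)$ with $\{(a,b),(c,d)\}\in Q_{\mathrm{good}}(W)$, and predict $1-\tilde y$, until a mistake occurs or $U=\emptyset$. If $U$ is exhausted without a mistake, stop; otherwise let $b$ be the node of the mistake. 3. Fix $W=U\cup\{a,b\}$. Repeatedly select the $c\in U$ that maximizes the number of $d$ with $\{(a,b),(c,d)\}\in Q_{\mathrm{good}}(W)$, and predict $\tilde y$, until a mistake occurs or $U=\emptyset$. If $U$ is exhausted without a mistake, stop; otherwise let $c$ be the node of the mistake. 4. For each $d\in U$ with $\{(a,b),(c,d)\}\in Q_{\mathrm{good}}(U\cup\{a,b,c\})$, select $d$ and predict $\tilde y$; leave this step at the first mistake. When $Q_{\mathrm{good}}(U)=\emptyset$, (Step 5) select the remaining nodes in any order with arbitrary predictions. Ties, arbitrary predictions and orders may be resolved in any way. **Statement.** Let $\omega(G)$ be the clique number of $G$. There is an absolute constant $C>0$ such that for every finite simple connected graph $G$ with $n\ge 2$ nodes that is chordal (it has no induced cycle of length at least four) or a circular-arc graph (an intersection graph of arcs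 on a circle), every implementation of Good4 satisfies $$\mathrm{M}_{\mathrm{sd}}(\textsc{Good4},\mathcal H)\le C\,\omega(G)^4\ln n .$$ -/

import Mathlib

/-! ### Geodesic convexity -/

/-- The geodesic interval `I(u,v)`: all nodes lying on some shortest `u`-`v` path. -/
def geodInterval {V : Type*} (G : SimpleGraph V) (u v : V) : Set V :=
  {x | ∃ p : G.Walk u v, p.length = G.dist u v ∧ x ∈ p.support}

/-- A node set is (geodesically) convex if it contains `I(a,b)` for all its members `a`, `b`. -/
def IsGeodConvex {V : Type*} (G : SimpleGraph V) (C : Set V) : Prop :=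
  ∀ a ∈ C, ∀ b ∈ C, geodInterval G a b ⊆ C

/-- The binary labelings whose two clusters are both convex (a cluster may be empty). -/
def convexBipartitions {V : Type*} (G : SimpleGraph V) : Set (V → Bool) :=
  {y | ∀ l : Bool, IsGeodConvex G {v | y v = l}}

/-! ### Self-directed learning -/

/-- What has been observed so far, most recent observation first: nodes with their true labels. -/
abbrev History (V : Type*) := List (V × Bool)

/-- A (deterministic) learner: from the observations made so far it determines the node that it
selects next and the label that it predicts for that node. -/
abbrev Learner (V : Type*) := History V → V × Bool

/-- The observations of the learner `A` in its first `t` trials, if the true labeling is `y`. -/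
def Learner.run {V : Type*} (A : Learner V) (y : V → Bool) : ℕ → History V
  | 0 => []
  | t + 1 => ((A (A.run y t)).1, y (A (A.run y t)).1) :: A.run y t

/-- The number of mistakes of `A` on the labeling `y` in the `n = |V|` trials. -/
def Learner.mistakes {V : Type*} [Fintype V] (A : Learner V) (y : V → Bool) : ℕ :=
  ((Finset.range (Fintype.card V)).filter
    fun t => (A (A.run y t)).2 ≠ y (A (A.run y t)).1).card

/-- The largest number of mistakes of `A` over the labelings in `H`. (The numbers of mistakes are
at most `|V|`, so the supremum is a maximum if `H` is nonempty.) -/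
noncomputable def mistakesSD {V : Type*} [Fintype V] (A : Learner V) (H : Set (V → Bool)) : ℕ :=
  sSup (A.mistakes '' H)

/-! ### Good quadruples -/

/-- The good quadruples `{(a,b),(c,d)}` in the node set `U`: unordered pairs of unordered pairs
with `a, b, c, d` four distinct nodes of `U`, such that some shortest `a`-`b` path and some shortest
`c`-`d` path share a node. -/
def goodQuads {V : Type*} (G : SimpleGraph V) (U : Set V) : Set (Sym2 (Sym2 V)) :=
  {q | ∃ a b c d : V, a ∈ U ∧ b ∈ U ∧ c ∈ U ∧ d ∈ U ∧ [a, b, c, d].Nodup ∧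
    (geodInterval G a b ∩ geodInterval G c d).Nonempty ∧ q = s(s(a, b), s(c, d))}

/-- The number of good quadruples in `U` in which `a` participates. -/
noncomputable def scoreA {V : Type*} (G : SimpleGraph V) (U : Set V) (a : V) : ℕ :=
  {q | q ∈ goodQuads G U ∧ ∃ (b : V) (e : Sym2 V), q = s(s(a, b), e)}.ncard

/-- The number of pairs `(c,d)` such that `{(a,b),(c,d)}` is a good quadruple in `W`. -/
noncomputable def scoreB {V : Type*} (G : SimpleGraph V) (W : Set V) (a b : V) : ℕ :=
  {e : Sym2 V | s(s(a, b), e) ∈ goodQuads G W}.ncard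

/-- The number of nodes `d` such that `{(a,b),(c,d)}` is a good quadruple in `W`. -/
noncomputable def scoreC {V : Type*} (G : SimpleGraph V) (W : Set V) (a b c : V) : ℕ :=
  {d : V | s(s(a, b), s(c, d)) ∈ goodQuads G W}.ncard

/-! ### The algorithm Good4 -/

namespace Good4

/-- The control state of the algorithm, between two trials.
* `main`: at the test of the outer loop.
* `findB a l W`: in the loop of Step 2; `a` is the node chosen in Step 1, `l` its observed label,
  `W` the set of nodes (the unlabeled ones and `a`) from which the scores of this loop are computed.
* `findC a b l W`: in the loop of Step 3; `b` is the node on which Step 2 made its mistake,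
  `W` the set (the then unlabeled nodes, `a` and `b`) from which the scores are computed.
* `sweep a b c l`: in the loop of Step 4; `c` is the node on which Step 3 made its mistake. -/
inductive Phase (V : Type*) where
  | main : Phase V
  | findB (a : V) (l : Bool) (W : Set V) : Phase V
  | findC (a b : V) (l : Bool) (W : Set V) : Phase V
  | sweep (a b c : V) (l : Bool) : Phase V

/-- The set `U` of unlabeled nodes together with the control state. -/
structure State (V : Type*) where
  unknown : Set V
  phase : Phase V

/-- The nodes `d ∈ U` over which Step 4 iterates. -/
def sweepSet {V : Type*} (G : SimpleGraph V) (U : Set V) (a b c : V) : Set V :=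
  {d | d ∈ U ∧ s(s(a, b), s(c, d)) ∈ goodQuads G (U ∪ {a, b, c})}

open Classical in
/-- Step 4 on the unlabeled nodes `U`: back to the outer loop if no node is left to iterate over. -/
noncomputable def enterSweep {V : Type*} (G : SimpleGraph V) (U : Set V) (a b c : V) (l : Bool) :
    Phase V :=
  if (sweepSet G U a b c).Nonempty then .sweep a b c l else .main

open Classical in
/-- The state after the node `v` was selected in state `s` and its label `r` was observed.
Step 2 predicts `!l`, so it makes a mistake if `r = l`; Steps 3 and 4 predict `l`, so they make a
mistake if `r ≠ l`. -/
noncomputable def next {V : Type*} (G : SimpleGraph V) (s : State V) (v : V) (r : Bool) : State V :=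
  let U := s.unknown \ {v}
  match s.phase with
  | .main => ⟨U, if (goodQuads G s.unknown).Nonempty then .findB v r (U ∪ {v}) else .main⟩
  | .findB a l W => ⟨U, if r = l then .findC a v l (U ∪ {a, v}) else .findB a l W⟩
  | .findC a b l W => ⟨U, if r = l then .findC a b l W else enterSweep G U a b v l⟩
  | .sweep a b c l => ⟨U, if r = l then enterSweep G U a b c l else .main⟩

/-- The state after the given observations. -/
noncomputable def stateAfter {V : Type*} (G : SimpleGraph V) : History V → State V
  | [] => ⟨Set.univ, .main⟩
  | (v, r) :: h => next G (stateAfter G h) v r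

/-- In state `s` the algorithm may select the node `v` and predict the label `p`. In phase `main`
(Step 1, or Step 5 if there is no good quadruple left) the prediction is arbitrary; ties between
maximizers, and the order of the nodes in Steps 4 and 5, are arbitrary. -/
def Allowed {V : Type*} (G : SimpleGraph V) (s : State V) (v : V) (p : Bool) : Prop :=
  v ∈ s.unknown ∧
  match s.phase with
  | .main => (goodQuads G s.unknown).Nonempty →
      ∀ v' ∈ s.unknown, scoreA G s.unknown v' ≤ scoreA G s.unknown v
  | .findB a l W => (∀ v' ∈ s.unknown, scoreB G W a v' ≤ scoreB G W a v) ∧ p = !l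
  | .findC a b l W => (∀ v' ∈ s.unknown, scoreC G W a b v' ≤ scoreC G W a b v) ∧ p = l
  | .sweep a b c l => v ∈ sweepSet G s.unknown a b c ∧ p = l

end Good4

/-- `A` is an implementation of Good4 on `G`, with some way of making the choices that the
algorithm leaves open: on every labeling each of the `n = |V|` trials is a legal step. -/
def IsGood4 {V : Type*} [Fintype V] (G : SimpleGraph V) (A : Learner V) : Prop :=
  ∀ y : V → Bool, ∀ t < Fintype.card V,
    Good4.Allowed G (Good4.stateAfter G (A.run y t)) (A (A.run y t)).1 (A (A.run y t)).2

/-! ### Graph classes -/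

/-- No induced cycle has four or more nodes. -/
def IsChordal {V : Type*} (G : SimpleGraph V) : Prop :=
  ∀ k : ℕ, 4 ≤ k → IsEmpty (SimpleGraph.cycleGraph k ↪g G)

/-- The (closed) arc of the circle `ℝ / ℤ` that runs from `s` to `t`, where `s ≤ t`. -/
def circleArc (s t : ℝ) : Set (AddCircle (1 : ℝ)) :=
  (fun x : ℝ => (x : AddCircle (1 : ℝ))) '' Set.Icc s t

/-- The intersection graphs of arcs on a circle. -/
def IsCircularArc {V : Type*} (G : SimpleGraph V) : Prop :=
  ∃ s t : V → ℝ, (∀ v, s v ≤ t v) ∧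
    ∀ u v, G.Adj u v ↔ u ≠ v ∧ (circleArc (s u) (t u) ∩ circleArc (s v) (t v)).Nonempty

/-! ### Good4 can be carried out on every finite graph -/

theorem Good4.exists_allowed {V : Type*} [Finite V] (G : SimpleGraph V) (h : History V)
    (hne : (Good4.stateAfter G h).unknown.Nonempty) :
    ∃ v p, Good4.Allowed G (Good4.stateAfter G h) v p := by
  have key : ∀ (U : Set V) (f : V → ℕ), U.Nonempty → ∃ v ∈ U, ∀ v' ∈ U, f v' ≤ f v :=
    fun U f hU => U.exists_max_image f U.toFinite hU
  have hsw : ∀ a b c l, (Good4.stateAfter G h).phase = .sweep a b c l →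
      (Good4.sweepSet G (Good4.stateAfter G h).unknown a b c).Nonempty := by
    intro a b c l hp
    cases h with
    | nil => simp [Good4.stateAfter] at hp
    | cons o h =>
      obtain ⟨v, r⟩ := o
      simp only [Good4.stateAfter, Good4.next] at hp ⊢
      split at hp <;> simp only [Good4.enterSweep] at hp ⊢ <;> split_ifs at hp <;> simp_all
  generalize Good4.stateAfter G h = s at hne hsw
  obtain ⟨U, ph⟩ := s
  cases ph with
  | main =>
    obtain ⟨v, hv, hm⟩ := key U (scoreA G U) hne
    exact ⟨v, true, hv, fun _ => hm⟩
  | findB a l W =>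
    obtain ⟨v, hv, hm⟩ := key U (scoreB G W a) hne
    exact ⟨v, !l, hv, hm, rfl⟩
  | findC a b l W =>
    obtain ⟨v, hv, hm⟩ := key U (scoreC G W a b) hne
    exact ⟨v, l, hv, hm, rfl⟩
  | sweep a b c l =>
    obtain ⟨v, hv⟩ := hsw a b c l rfl
    exact ⟨v, l, hv.1, hv, rfl⟩

theorem Good4.stateAfter_unknown {V : Type*} (G : SimpleGraph V) (h : History V) :
    (Good4.stateAfter G h).unknown = {v | v ∉ h.map Prod.fst} := by
  induction h with
  | nil => simp [Good4.stateAfter]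
  | cons o h ih =>
    obtain ⟨v, r⟩ := o
    have : (Good4.stateAfter G ((v, r) :: h)).unknown
        = (Good4.stateAfter G h).unknown \ {v} := by
      simp only [Good4.stateAfter, Good4.next]
      split <;> rfl
    rw [this, ih]
    ext x
    simp only [Set.mem_sdiff, Set.mem_ofPred_eq, Set.mem_singleton_iff, List.map_cons,
      List.mem_cons, not_or]
    tauto

theorem exists_isGood4 {V : Type*} [Fintype V] [Nonempty V] (G : SimpleGraph V) :
    ∃ A : Learner V, IsGood4 G A := by
  classical
  let A : Learner V := fun h =>
    if hx : ∃ q : V × Bool, Good4.Allowed G (Good4.stateAfter G h) q.1 q.2 then hx.choose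
    else (Classical.arbitrary V, true)
  have hlen : ∀ (y : V → Bool) t, (A.run y t).length = t := by
    intro y t
    induction t with
    | zero => rfl
    | succ t ih => simp [Learner.run, ih]
  refine ⟨A, fun y t ht => ?_⟩
  have hne : (Good4.stateAfter G (A.run y t)).unknown.Nonempty := by
    rw [Good4.stateAfter_unknown]
    by_contra hc
    rw [Set.not_nonempty_iff_eq_empty] at hc
    have hall : ∀ v : V, v ∈ (A.run y t).map Prod.fst := by
      intro v
      by_contra hv
      have : v ∈ ({v | v ∉ (A.run y t).map Prod.fst} : Set V) := hv
      rw [hc] at this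
      exact this
    have h1 : Fintype.card V ≤ ((A.run y t).map Prod.fst).toFinset.card := by
      rw [← Finset.card_univ]
      exact Finset.card_le_card fun v _ => by simpa using hall v
    have h2 := List.toFinset_card_le ((A.run y t).map Prod.fst)
    rw [List.length_map, hlen] at h2
    omega
  obtain ⟨v, p, hvp⟩ := Good4.exists_allowed G _ hne
  have hx : ∃ q : V × Bool, Good4.Allowed G (Good4.stateAfter G (A.run y t)) q.1 q.2 :=
    ⟨(v, p), hvp⟩
  have hA : A (A.run y t) = hx.choose := dif_pos hx
  rw [hA]
  exact hx.choose_spec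

/-! ### Good quadruples from separators -/

/-! If a good quadruple {(a,b),(c,d)} has label `l` on a and b and `!l` on c, then d has label `l`:
otherwise a node shared by the two geodesics would carry both labels. So Step 4 never errs, and a
round costs at most three mistakes, one in each of Steps 1 to 3.

Suppose every k nodes contain a good quadruple. By double counting, a fraction of order k^-4 of all
quadruples of unlabeled nodes is good (`pow_four_le_ncard_goodQuads`). The greedy a, b, c each
retain an average share of these, up to losses from nodes labeled within the round. Either those
nodes are many, or Step 4 has many d to sweep; so a completed round on m ≥ k nodes labels at least
`rate k * m` of them, and O(k^4 log n) rounds suffice. `Budget` carries this amortization from trial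
to trial.

It remains to take k linear in the clique number ω. If more than |K| nodes of S lie on either side
of a separator K, then |K| + 1 geodesics across K cannot all cross it at different nodes
(`goodQuads_nonempty_of_separator`). Chordal graphs have a balanced clique separator; in
circular-arc graphs the arcs through two suitable points, two cliques, form one. -/

theorem SimpleGraph.Walk.exists_mem_support_of_boundary {V : Type*} {G : SimpleGraph V}
    {D K : Set V} (h : ∀ x ∈ D, ∀ y, G.Adj x y → y ∈ D ∨ y ∈ K) {a b : V} (p : G.Walk a b)
    (ha : a ∈ D) (hb : b ∉ D) : ∃ x ∈ p.support, x ∈ K := by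
  induction p with
  | nil => exact absurd ha hb
  | @cons u v w huv p ih =>
    rcases h u ha v huv with hv | hv
    · obtain ⟨x, hx, hxK⟩ := ih hv hb
      exact ⟨x, by simp [hx], hxK⟩
    · exact ⟨v, by simp, hv⟩

/-- If more nodes of `S` than `#K` lie on either side of the separator `K`, then pairing them up
across `K` yields two pairs whose geodesics meet in `K`. -/
theorem goodQuads_nonempty_of_separator {V : Type*} {G : SimpleGraph V} (hG : G.Connected)
    {S : Set V} {K A B : Finset V} {D : Set V}
    (hD : ∀ x ∈ D, ∀ y, G.Adj x y → y ∈ D ∨ y ∈ K)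
    (hAS : ∀ x ∈ A, x ∈ S) (hBS : ∀ x ∈ B, x ∈ S) (hAD : ∀ x ∈ A, x ∈ D) (hBD : ∀ x ∈ B, x ∉ D)
    (hA : K.card < A.card) (hB : K.card < B.card) : (goodQuads G S).Nonempty := by
  classical
  obtain ⟨A', hA', hA'c⟩ := Finset.exists_subset_card_eq (Nat.succ_le_of_lt hA)
  obtain ⟨B', hB', hB'c⟩ := Finset.exists_subset_card_eq (Nat.succ_le_of_lt hB)
  have e : A' ≃ B' := Finset.equivOfCardEq (hA'c.trans hB'c.symm)
  have hgeo : ∀ a : A', ∃ x ∈ K, x ∈ geodInterval G a (e a) := by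
    intro a
    obtain ⟨p, hp⟩ := hG.exists_walk_length_eq_dist (a : V) (e a)
    obtain ⟨x, hx, hxK⟩ := p.exists_mem_support_of_boundary (K := (K : Set V)) hD
      (hAD _ (hA' a.2)) (hBD _ (hB' (e a).2))
    exact ⟨x, hxK, p, hp, hx⟩
  -- Pigeonhole: |K| + 1 geodesics, but only |K| nodes in which they can cross `K`.
  choose f hfK hf using hgeo
  obtain ⟨a, -, c, -, hac, hfac⟩ := Finset.exists_ne_map_eq_of_card_lt_of_maps_to
    (s := Finset.univ) (t := K) (f := f) (by simp [hA'c]) (fun a _ => hfK a)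
  have hne : ∀ u w : A', (u : V) ≠ e w := fun u w h =>
    hBD _ (hB' (e w).2) (h ▸ hAD _ (hA' u.2))
  have hee : (e a : V) ≠ e c := fun h => hac (e.injective (Subtype.ext h))
  have hac' : (a : V) ≠ c := fun h => hac (Subtype.ext h)
  refine ⟨_, a, e a, c, e c, hAS _ (hA' a.2), hBS _ (hB' (e a).2), hAS _ (hA' c.2),
    hBS _ (hB' (e c).2), ?_, ⟨f a, hf a, hfac ▸ hf c⟩, rfl⟩
  simp [hne, hac', hee, (hne c a).symm]

/-! ### Separators of chordal graphs -/

theorem SimpleGraph.nonempty_cycleGraph_embedding {V : Type*} {G : SimpleGraph V} {n : ℕ}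
    (g : ℕ → V) (hne : ∀ i j, i < j → j < n → g i ≠ g j)
    (hadj : ∀ i j, i < j → j < n → (G.Adj (g i) (g j) ↔ j = i + 1 ∨ (i = 0 ∧ j + 1 = n))) :
    Nonempty (SimpleGraph.cycleGraph n ↪g G) := by
  have key : ∀ u v : Fin n, u < v →
      (G.Adj (g u) (g v) ↔ (SimpleGraph.cycleGraph n).Adj u v) := by
    intro u v huv
    rw [hadj u v huv v.2, SimpleGraph.cycleGraph_adj', Fin.sub_val_of_le huv.le,
      Fin.coe_sub_iff_lt.2 huv]
    have := v.2
    have : (u : ℕ) < v := huv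
    omega
  refine ⟨⟨⟨fun i => g i, ?_⟩, ?_⟩⟩
  · intro u v huv
    rcases lt_trichotomy u v with h | h | h
    · exact absurd huv (hne u v h v.2)
    · exact h
    · exact absurd huv.symm (hne v u h u.2)
  · intro u v
    change G.Adj (g u) (g v) ↔ _
    rcases lt_trichotomy u v with h | h | h
    · exact key u v h
    · subst h; simp
    · rw [SimpleGraph.adj_comm, key v u h, SimpleGraph.adj_comm]

/-- In a chordal graph, if an induced path `f 0, …, f l` closes up to a cycle through adjacent
nodes `u`, `x` with `u` seeing only the end of the path, then `x` sees that end too. -/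
theorem IsChordal.adj_end {V : Type*} {G : SimpleGraph V} (hG : IsChordal G) {f : ℕ → V} {l : ℕ}
    {u x : V} (hne : ∀ i j, i < j → j ≤ l → f i ≠ f j)
    (hf : ∀ i j, i < j → j ≤ l → (G.Adj (f i) (f j) ↔ j = i + 1))
    (hu : ∀ i ≤ l, u ≠ f i) (hx : ∀ i ≤ l, x ≠ f i) (hxu : G.Adj x u)
    (hul : ∀ i ≤ l, (G.Adj u (f i) ↔ i = l)) (hx0 : G.Adj x (f 0)) : G.Adj x (f l) := by
  classical
  -- From the last neighbour `f i₀` of `x` on the path, the nodes `x`, `f i₀`, …, `f l`, `u` form an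
  -- induced cycle; its length `l - i₀ + 3` is at least 4 unless `i₀ = l`.
  let i₀ := Nat.findGreatest (fun i => G.Adj x (f i)) l
  have hi₀ : G.Adj x (f i₀) := Nat.findGreatest_spec (P := fun i => G.Adj x (f i)) l.zero_le hx0
  have hi₀l : i₀ ≤ l := Nat.findGreatest_le l
  have hmax : ∀ i, i₀ < i → i ≤ l → ¬ G.Adj x (f i) := fun i h1 h2 =>
    Nat.findGreatest_is_greatest h1 h2
  by_contra hcon
  have hlt : i₀ < l := lt_of_le_of_ne hi₀l fun h => hcon (h ▸ hi₀)
  clear_value i₀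
  let g : ℕ → V := fun i => if i = 0 then x else if i ≤ l - i₀ + 1 then f (i₀ + i - 1) else u
  have g0 : g 0 = x := rfl
  have g1 : ∀ i, 1 ≤ i → i ≤ l - i₀ + 1 → g i = f (i₀ + i - 1) := by
    intro i h1 h2
    simp only [g]
    rw [if_neg (by omega), if_pos h2]
  have g2 : g (l - i₀ + 2) = u := by
    simp only [g]
    rw [if_neg (by omega), if_neg (by omega)]
  refine (hG (l - i₀ + 3) (by omega)).false
    (SimpleGraph.nonempty_cycleGraph_embedding g ?_ ?_).some
  · intro i j hij hj
    rcases Nat.eq_zero_or_pos i with rfl | hi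
    · rw [g0]
      rcases Nat.lt_or_ge j (l - i₀ + 2) with h | h
      · rw [g1 j hij (by omega)]; exact hx _ (by omega)
      · obtain rfl : j = l - i₀ + 2 := by omega
        rw [g2]; exact hxu.ne
    · rw [g1 i hi (by omega)]
      rcases Nat.lt_or_ge j (l - i₀ + 2) with h | h
      · rw [g1 j (by omega) (by omega)]; exact hne _ _ (by omega) (by omega)
      · obtain rfl : j = l - i₀ + 2 := by omega
        rw [g2]; exact (hu _ (by omega)).symm
  · intro i j hij hj
    rcases Nat.eq_zero_or_pos i with rfl | hi
    · rw [g0]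
      rcases Nat.lt_or_ge j (l - i₀ + 2) with h | h
      · rw [g1 j hij (by omega)]
        rcases Nat.eq_or_lt_of_le hij with h1 | h1
        · obtain rfl : j = 1 := by omega
          simpa using hi₀
        · exact iff_of_false (hmax _ (by omega) (by omega)) (by omega)
      · obtain rfl : j = l - i₀ + 2 := by omega
        rw [g2]; exact iff_of_true hxu (by omega)
    · rw [g1 i hi (by omega)]
      rcases Nat.lt_or_ge j (l - i₀ + 2) with h | h
      · rw [g1 j (by omega) (by omega), hf _ _ (by omega) (by omega)]; omega
      · obtain rfl : j = l - i₀ + 2 := by omega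
        rw [g2, SimpleGraph.adj_comm, hul _ (by omega)]; omega

/-- In a chordal graph, a connected set whose boundary is a clique has a member adjacent to the
whole boundary. -/
theorem IsChordal.exists_adj_boundary {V : Type*} [Finite V] {G : SimpleGraph V}
    (hG : IsChordal G) {C N : Set V} (hC : (G.induce C).Connected) (hCN : Disjoint C N)
    (hN : G.IsClique N) (hadj : ∀ u ∈ N, ∃ w ∈ C, G.Adj u w) :
    ∃ v ∈ C, ∀ u ∈ N, G.Adj v u := by
  classical
  obtain ⟨⟨v₀, hv₀⟩⟩ := hC.nonempty
  -- Let `v` see as much of `N` as possible. If it misses `u`, let `w` be a neighbour of `u` in `C`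
  -- nearest to `v` inside `C`. A shortest path from `v` to `w` is induced and `u` sees only its
  -- end, so by `adj_end` `w` sees everything in `N` that `v` sees, and `u` as well.
  obtain ⟨v, hv, hmax⟩ := C.exists_max_image (fun v => {u ∈ N | G.Adj v u}.ncard) C.toFinite
    ⟨v₀, hv₀⟩
  refine ⟨v, hv, fun u hu => ?_⟩
  by_contra hvu
  obtain ⟨w, huw, hmin⟩ := Set.exists_min_image {w : C | G.Adj u w}
    (fun w => (G.induce C).dist ⟨v, hv⟩ w) (Set.toFinite _)
    (by obtain ⟨w, hw, h⟩ := hadj u hu; exact ⟨⟨w, hw⟩, h⟩)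
  have huw : G.Adj u w := huw
  obtain ⟨p, hp⟩ := hC.exists_walk_length_eq_dist ⟨v, hv⟩ w
  have hdist : ∀ i ≤ p.length, (G.induce C).dist ⟨v, hv⟩ (p.getVert i) = i := by
    intro i hi
    have h1 := SimpleGraph.dist_le (p.take i)
    have h2 := SimpleGraph.dist_le (p.drop i)
    have h3 := hC.dist_triangle (u := ⟨v, hv⟩) (v := p.getVert i) (w := w)
    rw [SimpleGraph.Walk.take_length] at h1
    rw [SimpleGraph.Walk.drop_length] at h2
    omega
  have hCu : ∀ z ∈ C, ∀ x ∈ N, x ≠ z := fun z hz x hx h =>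
    Set.disjoint_left.1 hCN hz (h ▸ hx)
  have hsub : {x ∈ N | G.Adj v x} ⊂ {x ∈ N | G.Adj w x} := by
    refine ⟨fun x hx => ⟨hx.1, ?_⟩, fun h => hvu (h ⟨hu, huw.symm⟩).2⟩
    have := hG.adj_end (f := fun i => (p.getVert i : V)) (l := p.length) (u := u) (x := x)
      ?_ ?_ (fun i _ => hCu _ (p.getVert i).2 u hu) (fun i _ => hCu _ (p.getVert i).2 x hx.1)
      (hN hx.1 hu fun h => hvu (h ▸ hx.2)) ?_ (by simpa using hx.2.symm)
    · simpa using this.symm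
    · intro i j hij hj h
      have := hdist i (by omega)
      rw [Subtype.ext h, hdist j hj] at this
      omega
    · intro i j hij hj
      constructor
      · intro h
        have h' : (G.induce C).Adj (p.getVert i) (p.getVert j) := h
        have := h'.diff_dist_adj (u := ⟨v, hv⟩)
        rw [hdist i (by omega), hdist j hj] at this
        omega
      · rintro rfl
        exact p.adj_getVert_succ (by omega)
    · intro i hi
      constructor
      · intro h
        have := hmin (p.getVert i) h
        simp only [hdist i hi, ← hp] at this
        omega
      · rintro rfl
        simpa using huw
  exact absurd (hmax w w.2) (not_le.2 (Set.ncard_lt_ncard hsub (Set.toFinite _)))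

/-- A nonempty set without edges to the rest of `M`, minimal as such, induces a connected graph. -/
theorem SimpleGraph.connected_induce_of_minimal {V : Type*} {G : SimpleGraph V} {M D : Set V}
    (hne : D.Nonempty) (hcl : ∀ x ∈ D, ∀ y ∈ M, G.Adj x y → y ∈ D)
    (hmin : ∀ R ⊆ D, R.Nonempty → (∀ x ∈ R, ∀ y ∈ M, G.Adj x y → y ∈ R) → R = D) :
    (G.induce D).Connected := by
  obtain ⟨x₀, hx₀⟩ := hne
  have : Nonempty D := ⟨⟨x₀, hx₀⟩⟩
  refine ⟨fun x y => ?_⟩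
  have hR := hmin {z | ∃ hz : z ∈ D, (G.induce D).Reachable x ⟨z, hz⟩} (fun z hz => hz.1)
    ⟨x, x.2, SimpleGraph.Reachable.refl _⟩ (by
      rintro z ⟨hz, hxz⟩ w hw hzw
      have hwD := hcl z hz w hw hzw
      have hadj : (G.induce D).Adj ⟨z, hz⟩ ⟨w, hwD⟩ := hzw
      exact ⟨hwD, hxz.trans hadj.reachable⟩)
  exact (hR.ge y.2).2

/-- The separator is a clique `K` consisting of the boundary of a minimal heavy set `C` and a node
`v` of `C` adjacent to all of it. Every component of `C` without `v` is light by minimality, so some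
union of components has a weight in `S` between ω + 1 and 2ω + 1. -/
theorem IsChordal.goodQuads_nonempty {V : Type*} [Finite V] {G : SimpleGraph V}
    (hconn : G.Connected) (hG : IsChordal G) {S : Finset V}
    (hS : 4 * G.cliqueNum + 2 ≤ S.card) : (goodQuads G (S : Set V)).Nonempty := by
  classical
  have := Fintype.ofFinite V
  set ω := G.cliqueNum with hω
  let bd : Finset V → Finset V := fun C => Finset.univ.filter fun u => u ∉ C ∧ ∃ w ∈ C, G.Adj u w
  have hbd : ∀ C u, u ∈ bd C ↔ u ∉ C ∧ ∃ w ∈ C, G.Adj u w := fun C u => by simp [bd]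
  -- The weight is at least ω + 2, so that ω + 1 nodes of `S` survive the removal of `v`.
  obtain ⟨C, hCmem, hCmin⟩ := Finset.exists_min_image
    (Finset.univ.filter fun C : Finset V => (G.induce (C : Set V)).Connected ∧
      G.IsClique (bd C : Set V) ∧ ω + 1 < (C ∩ S).card) Finset.card
    ⟨Finset.univ, by
      simp only [Finset.mem_filter, Finset.mem_univ, true_and, Finset.univ_inter]
      refine ⟨?_, ?_, by omega⟩
      · rw [Finset.coe_univ]
        exact (SimpleGraph.induceUnivIso G).connected_iff.2 hconn
      · intro u hu
        simp [bd] at hu⟩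
  simp only [Finset.mem_filter, Finset.mem_univ, true_and] at hCmem hCmin
  obtain ⟨hCc, hCbd, hCS⟩ := hCmem
  obtain ⟨v, hvC, hv⟩ := hG.exists_adj_boundary hCc
    (Set.disjoint_left.2 fun x hx hx' => ((hbd C x).1 hx').1 hx) hCbd
    (fun u hu => ((hbd C u).1 hu).2)
  set K := insert v (bd C) with hK
  have hKcl : G.IsClique (K : Set V) := by
    rw [hK, Finset.coe_insert]
    exact hCbd.insert fun b hb _ => hv b hb
  have hKcard : K.card ≤ ω := SimpleGraph.IsClique.card_le_cliqueNum (tc := hKcl)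
  set M := C.erase v with hM
  -- closed subsets of `M`
  let cl : Finset V → Prop := fun D => D ⊆ M ∧ ∀ x ∈ D, ∀ y ∈ M, G.Adj x y → y ∈ D
  -- The boundary of `D` lies in `K`, hence is a clique, and `D` is smaller than `C` because it
  -- misses `v`.
  have hcard_conn : ∀ D, cl D → (G.induce (D : Set V)).Connected → (D ∩ S).card ≤ ω + 1 := by
    intro D hD hDc
    by_contra hcon
    have hDK : (bd D : Set V) ⊆ K := by
      intro u hu
      obtain ⟨huD, w, hwD, huw⟩ := (hbd D u).1 hu
      have hwM := hD.1 hwD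
      by_cases huC : u ∈ C
      · by_cases huv : u = v
        · simp [hK, huv]
        · exact absurd (hD.2 w hwD u (Finset.mem_erase.2 ⟨huv, huC⟩) huw.symm) huD
      · exact Finset.mem_insert_of_mem ((hbd C u).2 ⟨huC, w, Finset.mem_of_mem_erase hwM, huw⟩)
    have h1 := hCmin D ⟨hDc, hKcl.subset hDK, by omega⟩
    have h2 := Finset.card_le_card hD.1
    have h3 := Finset.card_erase_lt_of_mem hvC
    rw [← hM] at h3
    omega
  have hMS : ω + 1 ≤ (M ∩ S).card := by
    have : C ∩ S ⊆ insert v (M ∩ S) := by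
      intro x hx
      simp only [hM, Finset.mem_insert, Finset.mem_inter, Finset.mem_erase] at hx ⊢
      tauto
    have := (Finset.card_le_card this).trans (Finset.card_insert_le _ _)
    omega
  -- `A` is a minimal union of components with weight at least ω + 1; dropping one component `D`
  -- leaves at most ω, and `D` itself weighs at most ω + 1.
  obtain ⟨A, hAmem, hAmin⟩ := Finset.exists_min_image
    (Finset.univ.filter fun A : Finset V => cl A ∧ ω + 1 ≤ (A ∩ S).card) Finset.card
    ⟨M, by
      simp only [Finset.mem_filter, Finset.mem_univ, true_and]
      exact ⟨⟨subset_rfl, fun x _ y hy _ => hy⟩, hMS⟩⟩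
  simp only [Finset.mem_filter, Finset.mem_univ, true_and] at hAmem hAmin
  obtain ⟨hA, hAS⟩ := hAmem
  have hAne : A.Nonempty := by
    rw [Finset.nonempty_iff_ne_empty]
    rintro rfl
    simp at hAS
  obtain ⟨D, hDmem, hDmin⟩ := Finset.exists_min_image
    (Finset.univ.filter fun D : Finset V => cl D ∧ D ⊆ A ∧ D.Nonempty) Finset.card
    ⟨A, by simp [hA, hAne]⟩
  simp only [Finset.mem_filter, Finset.mem_univ, true_and] at hDmem hDmin
  obtain ⟨hD, hDA, hDne⟩ := hDmem
  have hDc : (G.induce (D : Set V)).Connected := by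
    refine SimpleGraph.connected_induce_of_minimal (M := (M : Set V))
      hDne hD.2 fun R hRD hRne hR => ?_
    lift R to Finset V using Set.toFinite R
    rw [Finset.coe_subset] at hRD
    exact congrArg _ (Finset.eq_of_subset_of_card_le hRD
      (hDmin R ⟨⟨hRD.trans hD.1, hR⟩, hRD.trans hDA, hRne⟩))
  have hADcl : cl (A \ D) := by
    refine ⟨Finset.sdiff_subset.trans hA.1, fun x hx y hy hxy => ?_⟩
    rw [Finset.mem_sdiff] at hx ⊢
    exact ⟨hA.2 x hx.1 y hy hxy, fun hyD => hx.2 (hD.2 y hyD x (hA.1 hx.1) hxy.symm)⟩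
  have hAD : ((A \ D) ∩ S).card ≤ ω := by
    by_contra hcon
    have h1 := hAmin (A \ D) ⟨hADcl, by omega⟩
    have h2 := Finset.card_lt_card (Finset.sdiff_ssubset hDA hDne)
    omega
  have hAScard : (A ∩ S).card ≤ 2 * ω + 1 := by
    have h1 : A ∩ S ⊆ (A \ D) ∩ S ∪ D ∩ S := by
      intro x hx
      simp only [Finset.mem_union, Finset.mem_inter, Finset.mem_sdiff] at hx ⊢
      tauto
    have h2 := (Finset.card_le_card h1).trans (Finset.card_union_le _ _)
    have h3 := hcard_conn D hD hDc
    omega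
  refine goodQuads_nonempty_of_separator hconn (S := (S : Set V)) (K := K) (A := A ∩ S)
    (B := (S \ A) \ K) (D := (A : Set V)) ?_ ?_ ?_ ?_ ?_ (by omega) ?_
  · intro x hx y hxy
    by_cases hyC : y ∈ C
    · by_cases hyv : y = v
      · right; simp [hK, hyv]
      · exact Or.inl (hA.2 x hx y (Finset.mem_erase.2 ⟨hyv, hyC⟩) hxy)
    · exact Or.inr (Finset.mem_insert_of_mem
        ((hbd C y).2 ⟨hyC, x, Finset.mem_of_mem_erase (hA.1 hx), hxy.symm⟩))
  · intro x hx; exact (Finset.mem_inter.1 hx).2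
  · intro x hx
    simp only [Finset.mem_sdiff] at hx
    exact hx.1.1
  · intro x hx; exact (Finset.mem_inter.1 hx).1
  · intro x hx
    simp only [Finset.mem_sdiff] at hx
    exact hx.1.2
  -- (4ω + 2) - (2ω + 1) - ω = ω + 1 nodes of `S` remain on the other side.
  · have h1 := Finset.le_card_sdiff K (S \ A)
    have h2 := Finset.card_sdiff_add_card_inter S A
    rw [Finset.inter_comm] at h2
    omega

/-! ### Separators of circular-arc graphs -/

theorem AddCircle.coe_eq_coe_iff_exists_int {x y : ℝ} :
    (x : AddCircle (1 : ℝ)) = y ↔ ∃ k : ℤ, y = x + k := by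
  rw [eq_comm, ← sub_eq_zero, ← AddCircle.coe_sub, AddCircle.coe_eq_zero_iff]
  constructor <;> rintro ⟨k, hk⟩ <;> refine ⟨k, ?_⟩
  · simp at hk; linarith
  · simp; linarith

/-- Cutting the circle at `0`: the arcs that avoid `0` become intervals `[l v, r v]`. -/
theorem exists_intervals_of_arcs {V : Type*} (s t : V → ℝ) (hst : ∀ v, s v ≤ t v) :
    ∃ l r : V → ℝ, (∀ v, ∀ p : ℝ, l v ≤ p → p ≤ r v → (p : AddCircle (1 : ℝ)) ∈
        circleArc (s v) (t v)) ∧ (∀ v, l v ≤ r v) ∧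
      ∀ u v, ((0 : ℝ) : AddCircle (1 : ℝ)) ∉ circleArc (s u) (t u) →
        ((0 : ℝ) : AddCircle (1 : ℝ)) ∉ circleArc (s v) (t v) →
        (circleArc (s u) (t u) ∩ circleArc (s v) (t v)).Nonempty → l u ≤ r v := by
  refine ⟨fun v => s v - ⌊s v⌋, fun v => t v - ⌊s v⌋, fun v p h1 h2 => ?_,
    fun v => by linarith [hst v], ?_⟩
  · refine ⟨p + ⌊s v⌋, ⟨by linarith, by linarith⟩, ?_⟩
    rw [eq_comm, AddCircle.coe_eq_coe_iff_exists_int]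
    exact ⟨_, rfl⟩
  · intro u v hu hv ⟨z, ⟨x, hx, hxz⟩, ⟨y, hy, hyz⟩⟩
    have hbound : ∀ w, ((0 : ℝ) : AddCircle (1 : ℝ)) ∉ circleArc (s w) (t w) →
        t w < ⌊s w⌋ + 1 := by
      intro w hw
      -- Otherwise the arc would contain the integer `⌊s w⌋ + 1`, which is the point 0 of the
      -- circle.
      by_contra hcon
      refine hw ⟨((⌊s w⌋ + 1 : ℤ) : ℝ), ⟨?_, ?_⟩, ?_⟩
      · push_cast; exact (Int.lt_floor_add_one _).le
      · push_cast; linarith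
      · rw [eq_comm, AddCircle.coe_eq_coe_iff_exists_int]
        exact ⟨_, (zero_add _).symm⟩
    have hu' := hbound u hu
    have hv' := hbound v hv
    obtain ⟨k, hk⟩ := AddCircle.coe_eq_coe_iff_exists_int.1 (hxz.trans hyz.symm)
    have h1 := Int.floor_le (s u)
    have h2 := Int.floor_le (s v)
    -- Both lifts stay within one unit interval, so the shift that identifies their common point is
    -- the difference of the floors.
    have hk1 : ⌊s v⌋ - ⌊s u⌋ = k := by
      have h3 : ((⌊s v⌋ - ⌊s u⌋ - k : ℤ) : ℝ) < 1 := by push_cast; linarith [hx.2, hy.1, hx.1, hy.2]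
      have h4 : (-1 : ℝ) < ((⌊s v⌋ - ⌊s u⌋ - k : ℤ) : ℝ) := by
        push_cast; linarith [hx.2, hy.1, hx.1, hy.2]
      have h5 : ⌊s v⌋ - ⌊s u⌋ - k < 1 := by exact_mod_cast h3
      have h6 : -1 < ⌊s v⌋ - ⌊s u⌋ - k := by exact_mod_cast h4
      omega
    have hk2 : (⌊s v⌋ : ℝ) - ⌊s u⌋ = k := by exact_mod_cast hk1
    change s u - ⌊s u⌋ ≤ t v - ⌊s v⌋
    linarith [hx.1, hy.2]

/-- The arcs through a point form a clique. Cutting at 0 costs ω nodes of `S` and leaves intervals;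
a cut at a median right endpoint `p` then leaves at least 2ω + 1 nodes of `S` on each side, more
than the 2ω of both cliques together. -/
theorem IsCircularArc.goodQuads_nonempty {V : Type*} [Finite V] {G : SimpleGraph V}
    (hconn : G.Connected) (hG : IsCircularArc G) {S : Finset V}
    (hS : 7 * G.cliqueNum + 1 ≤ S.card) : (goodQuads G (S : Set V)).Nonempty := by
  classical
  have := Fintype.ofFinite V
  obtain ⟨s, t, hst, hadj⟩ := hG
  obtain ⟨l, r, hlr, hle, hcut⟩ := exists_intervals_of_arcs s t hst
  set ω := G.cliqueNum with hω
  have hpt : ∀ (p : ℝ) (K : Finset V), (∀ v ∈ K, (p : AddCircle (1 : ℝ)) ∈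
      circleArc (s v) (t v)) → K.card ≤ ω := by
    intro p K hK
    refine SimpleGraph.IsClique.card_le_cliqueNum (tc := ?_)
    intro u hu v hv huv
    exact (hadj u v).2 ⟨huv, _, hK u hu, hK v hv⟩
  let K₀ : Finset V := Finset.univ.filter fun v =>
    ((0 : ℝ) : AddCircle (1 : ℝ)) ∈ circleArc (s v) (t v)
  have hK₀ : K₀.card ≤ ω := hpt 0 K₀ fun v hv => (Finset.mem_filter.1 hv).2
  have hK₀' : ∀ v, v ∉ K₀ → ((0 : ℝ) : AddCircle (1 : ℝ)) ∉ circleArc (s v) (t v) :=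
    fun v hv h => hv (Finset.mem_filter.2 ⟨Finset.mem_univ _, h⟩)
  set S' := S \ K₀ with hS'
  have hS'c : 6 * ω + 1 ≤ S'.card := by
    have := Finset.le_card_sdiff K₀ S
    rw [← hS'] at this
    omega
  have hS'ne : S'.Nonempty := Finset.card_pos.1 (by omega)
  obtain ⟨q, hq, hqmax⟩ := S'.exists_max_image r hS'ne
  -- a median of the right endpoints
  obtain ⟨m, hm, hmin⟩ := (S'.filter fun v =>
    3 * ω + 1 ≤ (S'.filter fun w => r w ≤ r v).card).exists_min_image r
    ⟨q, by
      rw [Finset.mem_filter, Finset.filter_true_of_mem hqmax]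
      exact ⟨hq, by omega⟩⟩
  rw [Finset.mem_filter] at hm
  obtain ⟨hmS, hmc⟩ := hm
  set p := r m with hp
  let Kp : Finset V := Finset.univ.filter fun v => l v ≤ p ∧ p ≤ r v
  have hKp : Kp.card ≤ ω := hpt p Kp fun v hv => by
    have := (Finset.mem_filter.1 hv).2
    exact hlr v p this.1 this.2
  have hKpm : ∀ v, v ∈ Kp ↔ l v ≤ p ∧ p ≤ r v := fun v => by simp [Kp]
  set A := S'.filter fun v => r v < p with hA
  have hA1 : 2 * ω + 1 ≤ A.card := by
    have h1 : (S'.filter fun w => r w ≤ p) ⊆ A ∪ Kp := by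
      intro v hv
      rw [Finset.mem_filter] at hv
      rw [Finset.mem_union, hKpm, hA, Finset.mem_filter]
      rcases hv.2.lt_or_eq with h | h
      · exact Or.inl ⟨hv.1, h⟩
      · exact Or.inr ⟨h ▸ hle v, h.ge⟩
    have h2 := (Finset.card_le_card h1).trans (Finset.card_union_le _ _)
    omega
  have hA2 : A.card ≤ 3 * ω := by
    by_contra hcon
    obtain ⟨v, hv, hvmax⟩ := A.exists_max_image r (Finset.card_pos.1 (by omega))
    rw [hA, Finset.mem_filter] at hv
    refine absurd (hmin v ?_) (not_le.2 hv.2)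
    rw [Finset.mem_filter]
    refine ⟨hv.1, (Nat.succ_le_of_lt (not_le.1 hcon)).trans (Finset.card_le_card ?_)⟩
    intro w hw
    exact Finset.mem_filter.2 ⟨(Finset.mem_filter.1 hw).1, hvmax w hw⟩
  have hKc : (K₀ ∪ Kp).card ≤ 2 * ω := by
    have := Finset.card_union_le K₀ Kp
    omega
  refine goodQuads_nonempty_of_separator hconn (S := (S : Set V)) (K := K₀ ∪ Kp) (A := A)
    (B := (S' \ A) \ Kp) (D := {v | v ∉ K₀ ∧ r v < p}) ?_ ?_ ?_ ?_ ?_ (by omega) ?_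
  · rintro x ⟨hx, hxp⟩ y hxy
    by_cases hy : y ∈ K₀
    · exact Or.inr (Finset.mem_union_left _ hy)
    · rcases lt_or_ge (r y) p with h | h
      · exact Or.inl ⟨hy, h⟩
      · have := hcut y x (hK₀' y hy) (hK₀' x hx) ((hadj y x).1 hxy.symm).2
        exact Or.inr (Finset.mem_union_right _ ((hKpm y).2 ⟨by linarith, h⟩))
  · intro x hx
    exact (Finset.mem_sdiff.1 (Finset.mem_filter.1 hx).1).1
  · intro x hx
    simp only [Finset.mem_sdiff, hS'] at hx
    exact hx.1.1.1
  · intro x hx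
    exact ⟨(Finset.mem_sdiff.1 (Finset.mem_filter.1 hx).1).2, (Finset.mem_filter.1 hx).2⟩
  · rintro x hx ⟨-, hxp⟩
    simp only [Finset.mem_sdiff, hA, Finset.mem_filter] at hx
    exact hx.1.2 ⟨hx.1.1, hxp⟩
  · have h1 := Finset.le_card_sdiff Kp (S' \ A)
    have h2 := Finset.le_card_sdiff A S'
    omega

/-! ### Counting good quadruples -/

theorem geodInterval_comm {V : Type*} (G : SimpleGraph V) (u v : V) :
    geodInterval G u v = geodInterval G v u := by
  have : ∀ u v, geodInterval G u v ⊆ geodInterval G v u := by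
    rintro u v x ⟨p, hp, hx⟩
    exact ⟨p.reverse, by rw [SimpleGraph.Walk.length_reverse, hp, SimpleGraph.dist_comm],
      by simpa using hx⟩
  exact (this u v).antisymm (this v u)

theorem mem_goodQuads_iff {V : Type*} {G : SimpleGraph V} {U : Set V} {a b c d : V} :
    s(s(a, b), s(c, d)) ∈ goodQuads G U ↔ (a ∈ U ∧ b ∈ U ∧ c ∈ U ∧ d ∈ U) ∧
      [a, b, c, d].Nodup ∧ (geodInterval G a b ∩ geodInterval G c d).Nonempty := by
  constructor
  · rintro ⟨a', b', c', d', ha, hb, hc, hd, hn, hI, h⟩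
    simp only [List.nodup_cons, List.mem_cons, List.not_mem_nil, or_false, not_or,
      not_false_eq_true, List.nodup_nil, and_true] at hn ⊢
    obtain ⟨⟨h1, h2, h3⟩, ⟨h4, h5⟩, h6⟩ := hn
    have hI' := hI
    rw [Set.inter_comm] at hI'
    rcases Sym2.eq_iff.1 h with ⟨h7, h8⟩ | ⟨h7, h8⟩ <;>
      rcases Sym2.eq_iff.1 h7 with ⟨rfl, rfl⟩ | ⟨rfl, rfl⟩ <;>
      rcases Sym2.eq_iff.1 h8 with ⟨rfl, rfl⟩ | ⟨rfl, rfl⟩ <;>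
      refine ⟨by tauto, by tauto, ?_⟩ <;>
      first
      | exact hI
      | exact hI'
      | (rw [geodInterval_comm G a b]; first | exact hI | exact hI')
      | (rw [geodInterval_comm G c d]; first | exact hI | exact hI')
      | (rw [geodInterval_comm G a b, geodInterval_comm G c d]; first | exact hI | exact hI')
  · rintro ⟨⟨ha, hb, hc, hd⟩, hn, hI⟩
    exact ⟨a, b, c, d, ha, hb, hc, hd, hn, hI, rfl⟩

theorem goodQuads_mono {V : Type*} {G : SimpleGraph V} {U W : Set V} (h : U ⊆ W) :
    goodQuads G U ⊆ goodQuads G W := by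
  rintro q ⟨a, b, c, d, ha, hb, hc, hd, hn, hI, rfl⟩
  exact ⟨a, b, c, d, h ha, h hb, h hc, h hd, hn, hI, rfl⟩

theorem Set.ncard_le_mul_of_subset_biUnion {ι α : Type*} [Finite ι] [Finite α] {s : Set α}
    {F : Set ι} {t : ι → Set α} {N : ℕ} (hs : s ⊆ ⋃ i ∈ F, t i) (hN : ∀ i ∈ F, (t i).ncard ≤ N) :
    s.ncard ≤ F.ncard * N := by
  classical
  have := Fintype.ofFinite α
  lift F to Finset ι using F.toFinite
  have h : s ⊆ ((F.biUnion fun i => (t i).toFinset : Finset α) : Set α) := by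
    simpa using hs
  calc s.ncard ≤ ((F.biUnion fun i => (t i).toFinset : Finset α) : Set α).ncard :=
        Set.ncard_le_ncard h (Set.toFinite _)
    _ = (F.biUnion fun i => (t i).toFinset).card := Set.ncard_coe_finset _
    _ ≤ F.card * N := Finset.card_biUnion_le_card_mul _ _ _ fun i hi => by
        rw [← Set.ncard_eq_toFinset_card']; exact hN i hi
    _ = (F : Set ι).ncard * N := by rw [Set.ncard_coe_finset]

/-- If every `k`-subset contains a good quadruple, then a positive fraction of all quadruples is
good. -/
theorem pow_four_le_ncard_goodQuads {V : Type*} [Finite V] {G : SimpleGraph V} {k : ℕ}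
    (hk : 6 ≤ k) (hG : ∀ S : Finset V, S.card = k → (goodQuads G (S : Set V)).Nonempty)
    (U : Set V) (hU : k ≤ U.ncard) :
    U.ncard ^ 4 ≤ 16 * k ^ 4 * (goodQuads G U).ncard := by
  classical
  have := Fintype.ofFinite V
  lift U to Finset V using U.toFinite
  rw [Set.ncard_coe_finset] at hU ⊢
  set m := U.card with hm
  let Q : Finset (Finset V) := (U.powersetCard 4).filter fun q : Finset V =>
    (goodQuads G (q : Set V)).Nonempty
  -- Each `k`-subset contains a good 4-set, and each 4-set lies in `(m - 4).choose (k - 4)` of the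
  -- `k`-subsets.
  have hcount : (U.powersetCard k).card ≤ Q.card * (m - 4).choose (k - 4) := by
    have h1 : U.powersetCard k ⊆ Q.biUnion fun q => (U.powersetCard k).filter (q ⊆ ·) := by
      intro T hT
      obtain ⟨hTU, hTk⟩ := Finset.mem_powersetCard.1 hT
      obtain ⟨z, a, b, c, d, ha, hb, hc, hd, hn, hI, -⟩ := hG T hTk
      have hq : ([a, b, c, d].toFinset : Finset V).card = 4 :=
        List.toFinset_card_of_nodup hn
      have hqT : ([a, b, c, d].toFinset : Finset V) ⊆ T := by
        intro x hx
        simp only [List.mem_toFinset, List.mem_cons, List.not_mem_nil, or_false] at hx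
        rcases hx with rfl | rfl | rfl | rfl <;> assumption
      refine Finset.mem_biUnion.2 ⟨[a, b, c, d].toFinset, ?_, Finset.mem_filter.2 ⟨hT, hqT⟩⟩
      refine Finset.mem_filter.2 ⟨Finset.mem_powersetCard.2 ⟨hqT.trans hTU, hq⟩, ?_⟩
      exact ⟨_, mem_goodQuads_iff.2 ⟨by simp, hn, hI⟩⟩
    refine (Finset.card_le_card h1).trans (Finset.card_biUnion_le_card_mul _ _ _ ?_)
    intro q hq
    obtain ⟨hqU, hq4⟩ := Finset.mem_powersetCard.1 (Finset.mem_filter.1 hq).1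
    rw [Finset.card_filter_powersetCard_subset _ _ _ hqU (by omega), hq4]
  -- A good quadruple inside a 4-set uses all its nodes, so `φ` maps the good quadruples onto `Q`.
  have hQ : Q.card ≤ (goodQuads G (U : Set V)).ncard := by
    let φ : Sym2 (Sym2 V) → Finset V := fun z => Finset.univ.filter fun v => ∃ e ∈ z, v ∈ e
    have h1 : (Q : Set (Finset V)) ⊆ φ '' goodQuads G (U : Set V) := by
      intro q hq
      obtain ⟨h2, h3⟩ := Finset.mem_filter.1 hq
      obtain ⟨hqU, hq4⟩ := Finset.mem_powersetCard.1 h2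
      obtain ⟨z, hz⟩ := h3
      refine ⟨z, goodQuads_mono (Finset.coe_subset.2 hqU) hz, ?_⟩
      obtain ⟨a, b, c, d, ha, hb, hc, hd, hn, -, rfl⟩ := hz
      have h4 : φ s(s(a, b), s(c, d)) = [a, b, c, d].toFinset := by
        ext v
        simp [φ, or_assoc]
      rw [h4]
      refine Finset.eq_of_subset_of_card_le ?_ ?_
      · intro x hx
        simp only [List.mem_toFinset, List.mem_cons, List.not_mem_nil, or_false] at hx
        rcases hx with rfl | rfl | rfl | rfl <;> assumption
      · rw [hq4, List.toFinset_card_of_nodup hn]; rfl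
    have h2 := (Set.ncard_le_ncard h1 (Set.toFinite _)).trans (Set.ncard_image_le (Set.toFinite _))
    rwa [Set.ncard_coe_finset] at h2
  rw [Finset.card_powersetCard] at hcount
  have hpos : 0 < (m - 4).choose (k - 4) := Nat.choose_pos (by omega)
  have hch : m.choose 4 ≤ Q.card * k.choose 4 := by
    have h1 := Nat.choose_mul (n := m) (k := k) (s := 4) (by omega)
    have h2 := Nat.mul_le_mul_right (k.choose 4) hcount
    rw [h1] at h2
    refine Nat.le_of_mul_le_mul_right (h2.trans_eq ?_) hpos
    ring
  have hm4 : (m - 3) ^ 4 ≤ 24 * m.choose 4 := by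
    have := Nat.pow_sub_le_descFactorial m 4
    rwa [Nat.descFactorial_eq_factorial_mul_choose] at this
  have hk4 : 24 * k.choose 4 ≤ k ^ 4 := by
    have := Nat.descFactorial_le_pow k 4
    rwa [Nat.descFactorial_eq_factorial_mul_choose] at this
  -- `m ≤ 2 * (m - 3)` because `6 ≤ k ≤ m`.
  calc m ^ 4 ≤ (2 * (m - 3)) ^ 4 := Nat.pow_le_pow_left (by omega) 4
    _ = 16 * (m - 3) ^ 4 := by ring
    _ ≤ 16 * (24 * (Q.card * k.choose 4)) := by gcongr; exact hm4.trans (by gcongr)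
    _ = 16 * (24 * k.choose 4) * Q.card := by ring
    _ ≤ 16 * k ^ 4 * (goodQuads G (U : Set V)).ncard := by gcongr

section Scores

variable {V : Type*} [Finite V] {G : SimpleGraph V}

theorem ncard_goodQuads_le_of_scoreA_le {U : Set V} {N : ℕ} (hN : ∀ v ∈ U, scoreA G U v ≤ N) :
    (goodQuads G U).ncard ≤ U.ncard * N := by
  refine Set.ncard_le_mul_of_subset_biUnion ?_ hN
  rintro q hq
  obtain ⟨a, b, c, d, ha, hb, hc, hd, hn, hI, rfl⟩ := id hq
  exact Set.mem_biUnion ha ⟨hq, b, _, rfl⟩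

theorem scoreC_le_ncard (W : Set V) (a b c : V) : scoreC G W a b c ≤ W.ncard :=
  Set.ncard_le_ncard (fun _ hd => (mem_goodQuads_iff.1 hd).1.2.2.2) (Set.toFinite _)

/-- Scores are computed in the frozen set `W`, but maximality is known only over the still unlabeled
`U`; the nodes of `W \ U` are charged trivially. -/
theorem scoreB_le_of_scoreC_le {U W : Set V} {a b : V} {N : ℕ}
    (hN : ∀ v ∈ U, scoreC G W a b v ≤ N) :
    scoreB G W a b ≤ U.ncard * N + (W \ U).ncard * W.ncard := by
  let t : V → Set (Sym2 V) := fun c =>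
    (fun d => s(c, d)) '' {d | s(s(a, b), s(c, d)) ∈ goodQuads G W}
  have ht : ∀ c, (t c).ncard ≤ scoreC G W a b c := fun c => Set.ncard_image_le (Set.toFinite _)
  have hsub : {e : Sym2 V | s(s(a, b), e) ∈ goodQuads G W} ⊆
      (⋃ c ∈ U, t c) ∪ ⋃ c ∈ W \ U, t c := by
    intro e he
    induction e with
    | h c d =>
      have hct : s(c, d) ∈ t c := ⟨d, he, rfl⟩
      by_cases hcU : c ∈ U
      · exact Or.inl (Set.mem_biUnion hcU hct)
      · exact Or.inr (Set.mem_biUnion ⟨(mem_goodQuads_iff.1 he).1.2.2.1, hcU⟩ hct)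
  refine (Set.ncard_le_ncard hsub (Set.toFinite _)).trans ((Set.ncard_union_le _ _).trans ?_)
  exact Nat.add_le_add
    (Set.ncard_le_mul_of_subset_biUnion subset_rfl fun c hc => (ht c).trans (hN c hc))
    (Set.ncard_le_mul_of_subset_biUnion subset_rfl
      fun c _ => (ht c).trans (scoreC_le_ncard W a b c))

theorem scoreB_le_ncard_sq (W : Set V) (a b : V) : scoreB G W a b ≤ W.ncard ^ 2 := by
  have := scoreB_le_of_scoreC_le (U := W) fun c _ => scoreC_le_ncard (G := G) W a b c
  simpa [sq] using this

theorem scoreA_le_of_scoreB_le {U W : Set V} {a : V} {N : ℕ}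
    (hN : ∀ v ∈ U, scoreB G W a v ≤ N) :
    scoreA G W a ≤ U.ncard * N + (W \ U).ncard * W.ncard ^ 2 := by
  let t : V → Set (Sym2 (Sym2 V)) := fun b =>
    (fun e => s(s(a, b), e)) '' {e | s(s(a, b), e) ∈ goodQuads G W}
  have ht : ∀ b, (t b).ncard ≤ scoreB G W a b := fun b => Set.ncard_image_le (Set.toFinite _)
  have hsub : {q | q ∈ goodQuads G W ∧ ∃ (b : V) (e : Sym2 V), q = s(s(a, b), e)} ⊆
      (⋃ b ∈ U, t b) ∪ ⋃ b ∈ W \ U, t b := by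
    rintro q ⟨hq, b, e, rfl⟩
    have hbt : s(s(a, b), e) ∈ t b := ⟨e, hq, rfl⟩
    have hbW : b ∈ W := by
      induction e with
      | h c d => exact (mem_goodQuads_iff.1 hq).1.2.1
    by_cases hbU : b ∈ U
    · exact Or.inl (Set.mem_biUnion hbU hbt)
    · exact Or.inr (Set.mem_biUnion ⟨hbW, hbU⟩ hbt)
  refine (Set.ncard_le_ncard hsub (Set.toFinite _)).trans ((Set.ncard_union_le _ _).trans ?_)
  exact Nat.add_le_add
    (Set.ncard_le_mul_of_subset_biUnion subset_rfl fun c hc => (ht c).trans (hN c hc))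
    (Set.ncard_le_mul_of_subset_biUnion subset_rfl
      fun c _ => (ht c).trans (scoreB_le_ncard_sq W a c))

/-- Step 3 recomputes scores in a smaller set; every pair lost thereby contains a node of `W \ W'`.
-/
theorem scoreB_le_scoreB_add (W W' : Set V) {a b : V} (ha : a ∈ W') (hb : b ∈ W') :
    scoreB G W a b ≤ scoreB G W' a b + (W \ W').ncard * W.ncard := by
  have hsub : {e : Sym2 V | s(s(a, b), e) ∈ goodQuads G W} ⊆
      {e : Sym2 V | s(s(a, b), e) ∈ goodQuads G W'} ∪
        ⋃ c ∈ W \ W', (fun d => s(c, d)) '' W := by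
    intro e he
    induction e with
    | h c d =>
      obtain ⟨⟨-, -, hc, hd⟩, hn, hI⟩ := mem_goodQuads_iff.1 he
      by_cases hc' : c ∈ W'
      · by_cases hd' : d ∈ W'
        · exact Or.inl (mem_goodQuads_iff.2 ⟨⟨ha, hb, hc', hd'⟩, hn, hI⟩)
        · exact Or.inr (Set.mem_biUnion ⟨hd, hd'⟩ ⟨c, hc, Sym2.eq_swap⟩)
      · exact Or.inr (Set.mem_biUnion ⟨hc, hc'⟩ ⟨d, hd, rfl⟩)
  refine (Set.ncard_le_ncard hsub (Set.toFinite _)).trans ((Set.ncard_union_le _ _).trans ?_)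
  exact Nat.add_le_add le_rfl (Set.ncard_le_mul_of_subset_biUnion subset_rfl
    fun c _ => Set.ncard_image_le (Set.toFinite _))

theorem scoreC_le_ncard_sweepSet_add (U W : Set V) (a b c : V) :
    scoreC G W a b c ≤ (Good4.sweepSet G U a b c).ncard + (W \ U).ncard := by
  refine (Set.ncard_le_ncard (t := Good4.sweepSet G U a b c ∪ (W \ U)) ?_ (Set.toFinite _)).trans
    (Set.ncard_union_le _ _)
  intro d hd
  obtain ⟨⟨-, -, -, hdW⟩, hn, hI⟩ := mem_goodQuads_iff.1 hd
  by_cases hdU : d ∈ U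
  · exact Or.inl ⟨hdU, mem_goodQuads_iff.2 ⟨by simp [hdU], hn, hI⟩⟩
  · exact Or.inr ⟨hdW, hdU⟩

end Scores

/-! ### Mistake bound for Good4 -/

namespace Good4

/-- The fraction of the unlabeled nodes that a completed round of Good4 labels. -/
noncomputable def rate (k : ℕ) : ℝ := 1 / (80 * (k : ℝ) ^ 4)

/-- The mistake bound at the start of a round with `m` unlabeled nodes. -/
noncomputable def bound (k m : ℕ) : ℝ := k + 3 + 3 / rate k * Real.log m

/-- A condition on states that guarantees at most `x` further mistakes on the labeling `y`. -/
def Budget {V : Type*} (G : SimpleGraph V) (y : V → Bool) (k : ℕ) (s : State V) (x : ℝ) : Prop :=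
  (s.unknown.ncard : ℝ) ≤ x ∨
  match s.phase with
  | .main => bound k s.unknown.ncard ≤ x
  | .findB a l W => ∃ m : ℕ, k ≤ m ∧ W.ncard ≤ m ∧ s.unknown ⊆ W ∧ a ∈ W ∧ y a = l ∧
      5 * rate k * m ^ 3 ≤ scoreA G W a ∧ bound k m - 1 ≤ x
  | .findC a b l W => ∃ m : ℕ, k ≤ m ∧ W.ncard ≤ m ∧ s.unknown ⊆ W ∧ y a = l ∧ y b = l ∧
      ((s.unknown.ncard : ℝ) ≤ (1 - rate k) * m ∨ 3 * rate k * m ^ 2 ≤ scoreB G W a b) ∧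
      bound k m - 2 ≤ x
  | .sweep a b c l => ∃ m : ℕ, k ≤ m ∧ y a = l ∧ y b = l ∧ y c = !l ∧
      ((s.unknown \ sweepSet G s.unknown a b c).ncard : ℝ) ≤ (1 - rate k) * m ∧
      bound k m - 3 ≤ x

theorem rate_pos {k : ℕ} (hk : 0 < k) : 0 < rate k := by
  unfold rate; positivity

theorem le_bound {k : ℕ} (hk : 0 < k) (m : ℕ) : (k : ℝ) + 3 ≤ bound k m := by
  have h1 := rate_pos hk
  have h2 : 0 ≤ Real.log m := Real.log_natCast_nonneg m
  have : 0 ≤ 3 / rate k * Real.log m := by positivity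
  unfold bound
  linarith

/-- Since log(1 - r) ≤ -r, such a round lowers the logarithm by at least `rate k`; the factor `3 /
rate k` turns this into payment for three mistakes. -/
theorem bound_le_sub {k m u : ℕ} (hk : 0 < k) (hu : 0 < u) (hm : 0 < m)
    (h : (u : ℝ) ≤ (1 - rate k) * m) : bound k u ≤ bound k m - 3 := by
  have hr := rate_pos hk
  have hu' : (0 : ℝ) < u := by exact_mod_cast hu
  have hm' : (0 : ℝ) < m := by exact_mod_cast hm
  have h1 : 0 < 1 - rate k := by
    by_contra hcon
    nlinarith
  have h2 : Real.log u ≤ Real.log m - rate k := by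
    have := Real.log_le_log hu' h
    rw [Real.log_mul h1.ne' hm'.ne'] at this
    linarith [Real.log_le_sub_one_of_pos h1]
  have h3 : 3 / rate k * Real.log u ≤ 3 / rate k * (Real.log m - rate k) := by gcongr
  have h4 : 3 / rate k * (Real.log m - rate k) = 3 / rate k * Real.log m - 3 := by
    field_simp
  unfold bound
  linarith

variable {V : Type*} {G : SimpleGraph V} {y : V → Bool} {k : ℕ}

/-- The `+ 3` in `bound` covers the mistakes of a round that is never completed. -/
theorem Budget.nonneg (hk : 0 < k) {s : State V} {x : ℝ} (h : Budget G y k s x) : 0 ≤ x := by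
  have hk' : (0 : ℝ) ≤ k := k.cast_nonneg
  rcases h with h | h
  · exact (Nat.cast_nonneg _).trans h
  · obtain ⟨U, ph⟩ := s
    cases ph with
    | main => linarith [le_bound hk U.ncard, show bound k U.ncard ≤ x from h]
    | findB a l W =>
      obtain ⟨m, -, -, -, -, -, -, hx⟩ := h
      linarith [le_bound hk m]
    | findC a b l W =>
      obtain ⟨m, -, -, -, -, -, -, hx⟩ := h
      linarith [le_bound hk m]
    | sweep a b c l =>
      obtain ⟨m, -, -, -, -, -, hx⟩ := h
      linarith [le_bound hk m]

theorem budget_enterSweep (hk : 0 < k) {U : Set V} {a b c : V} {l : Bool} {m : ℕ} {x : ℝ}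
    (hm : k ≤ m) (ha : y a = l) (hb : y b = l) (hc : y c = !l)
    (hU : ((U \ sweepSet G U a b c).ncard : ℝ) ≤ (1 - rate k) * m) (hx : bound k m - 3 ≤ x) :
    Budget G y k ⟨U, enterSweep G U a b c l⟩ x := by
  unfold enterSweep
  split_ifs with h
  · exact Or.inr ⟨m, hm, ha, hb, hc, hU, hx⟩
  · rw [Set.not_nonempty_iff_eq_empty] at h
    rw [h, Set.sdiff_empty] at hU
    -- As `Real.log 0 = 0`, the potential of an empty set need not have dropped by 3; the first
    -- alternative of `Budget` serves instead.
    rcases Nat.eq_zero_or_pos U.ncard with h0 | h0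
    · left
      change (U.ncard : ℝ) ≤ x
      rw [h0]
      have := le_bound hk m
      have hk' : (0 : ℝ) ≤ k := k.cast_nonneg
      push_cast
      linarith
    · exact Or.inr ((bound_le_sub hk h0 (by omega) hU).trans hx)

variable [Finite V]

theorem cast_ncard_sdiff {U W : Set V} (h : U ⊆ W) :
    ((W \ U).ncard : ℝ) = W.ncard - U.ncard := by
  rw [Set.ncard_sdiff h (Set.toFinite _), Nat.cast_sub (Set.ncard_le_ncard h (Set.toFinite _))]

theorem budget_next_main (hk : 6 ≤ k)
    (hG : ∀ S : Finset V, S.card = k → (goodQuads G (S : Set V)).Nonempty) {U : Set V} {v : V}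
    {x x' : ℝ} (hxx : x - 1 ≤ x') (hv : v ∈ U) (hU : k ≤ U.ncard)
    (hmax : (goodQuads G U).Nonempty → ∀ v' ∈ U, scoreA G U v' ≤ scoreA G U v)
    (hx : bound k U.ncard ≤ x) : Budget G y k (next G ⟨U, .main⟩ v (y v)) x' := by
  have hcount := pow_four_le_ncard_goodQuads hk hG U hU
  have hm0 : 0 < U.ncard := by omega
  have hne : (goodQuads G U).Nonempty := by
    refine Set.nonempty_of_ncard_ne_zero fun h => ?_
    rw [h, mul_zero] at hcount
    exact absurd hcount (not_le.2 (by positivity))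
  have hU' : U \ {v} ∪ {v} = U := Set.sdiff_union_of_subset (by simpa using hv)
  simp only [next, if_pos hne, hU']
  refine Or.inr ⟨U.ncard, hU, le_rfl, Set.sdiff_subset, hv, rfl, ?_, by linarith⟩
  have hA := ncard_goodQuads_le_of_scoreA_le (hmax hne)
  have h1 : U.ncard ^ 3 ≤ 16 * k ^ 4 * scoreA G U v := by
    refine Nat.le_of_mul_le_mul_left ?_ hm0
    calc U.ncard * U.ncard ^ 3 = U.ncard ^ 4 := by ring
      _ ≤ 16 * k ^ 4 * (goodQuads G U).ncard := hcount
      _ ≤ 16 * k ^ 4 * (U.ncard * scoreA G U v) := by gcongr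
      _ = _ := by ring
  have h2 : (U.ncard : ℝ) ^ 3 ≤ 16 * (k : ℝ) ^ 4 * scoreA G U v := by exact_mod_cast h1
  have hk4 : (0 : ℝ) < (k : ℝ) ^ 4 := by positivity
  -- The 80 in `rate` is 16 · 5: 16 from the count of good quadruples, and five units of which Steps
  -- 2 and 3 lose two each, leaving one for the sweep.
  have h3 : 5 * rate k * (U.ncard : ℝ) ^ 3 = (U.ncard : ℝ) ^ 3 / (16 * (k : ℝ) ^ 4) := by
    unfold rate; field_simp; norm_num
  rw [h3, div_le_iff₀ (by positivity)]
  linarith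

/-- If at most `rate k * m` nodes are gone, averaging over b lowers the coefficient from 5 to 4, and
passing to the new `W` lowers it to 3. -/
theorem budget_next_findB (hk : 0 < k) {U W : Set V} {a v : V} {l : Bool} {m : ℕ} {x x' : ℝ}
    (hv : v ∈ U) (hmax : ∀ v' ∈ U, scoreB G W a v' ≤ scoreB G W a v)
    (hm : k ≤ m) (hWm : W.ncard ≤ m) (hUW : U ⊆ W) (haW : a ∈ W) (ha : y a = l)
    (hA : 5 * rate k * m ^ 3 ≤ scoreA G W a) (hx : bound k m - 1 ≤ x)
    (hxx : x - 1 ≤ x') (hxx' : y v ≠ l → x ≤ x') :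
    Budget G y k (next G ⟨U, .findB a l W⟩ v (y v)) x' := by
  simp only [next]
  split_ifs with hl
  · set W' := U \ {v} ∪ {a, v} with hW'
    have hUW' : U ⊆ W' := by
      intro z hz
      by_cases hzv : z = v
      · right; simp [hzv]
      · exact Or.inl ⟨hz, hzv⟩
    have hW'W : W' ⊆ W := by
      rintro z (hz | rfl | rfl)
      · exact hUW hz.1
      · exact haW
      · exact hUW hv
    refine Or.inr ⟨m, hm, (Set.ncard_le_ncard hW'W (Set.toFinite _)).trans hWm,
      Set.subset_union_left, ha, hl, ?_, by linarith⟩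
    change ((U \ {v}).ncard : ℝ) ≤ _ ∨ _
    rw [or_iff_not_imp_left, not_le]
    intro hU'
    have hr := rate_pos hk
    have hm0 : (0 : ℝ) < m := by exact_mod_cast (by omega : 0 < m)
    have hWm' : (W.ncard : ℝ) ≤ m := by exact_mod_cast hWm
    have hUU : ((U \ {v}).ncard : ℝ) ≤ U.ncard := by
      exact_mod_cast Set.ncard_le_ncard Set.sdiff_subset (Set.toFinite _)
    have hUm : (U.ncard : ℝ) ≤ m := by
      exact_mod_cast (Set.ncard_le_ncard hUW (Set.toFinite _)).trans hWm
    have h1 : ((W \ U).ncard : ℝ) ≤ rate k * m := by rw [cast_ncard_sdiff hUW]; linarith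
    have h2 : ((W \ W').ncard : ℝ) ≤ rate k * m := by
      refine le_trans ?_ h1
      exact_mod_cast Set.ncard_le_ncard (Set.sdiff_subset_sdiff_right hUW') (Set.toFinite _)
    have h3 : (scoreA G W a : ℝ) ≤ U.ncard * scoreB G W a v + (W \ U).ncard * W.ncard ^ 2 := by
      exact_mod_cast scoreA_le_of_scoreB_le hmax
    have h4 : (scoreB G W a v : ℝ) ≤ scoreB G W' a v + (W \ W').ncard * W.ncard := by
      exact_mod_cast scoreB_le_scoreB_add W W' (a := a) (b := v) (by simp [hW']) (by simp [hW'])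
    have h5 : ((W \ U).ncard : ℝ) * W.ncard ^ 2 ≤ rate k * m * m ^ 2 := by gcongr
    have h6 : ((W \ W').ncard : ℝ) * W.ncard ≤ rate k * m * m := by gcongr
    have h7 : (U.ncard : ℝ) * scoreB G W a v ≤ m * scoreB G W a v := by gcongr
    have h8 : 4 * rate k * m ^ 2 ≤ scoreB G W a v := by
      refine le_of_mul_le_mul_left ?_ hm0
      linarith
    linarith
  · exact Or.inr ⟨m, hm, hWm, Set.sdiff_subset.trans hUW, haW, ha, hA, hx.trans (hxx' hl)⟩

/-- Averaging over c lowers the coefficient from 3 to 2, and discarding the d already labeled leaves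
`rate k * m` nodes to sweep. -/
theorem budget_next_findC (hk : 0 < k) {U W : Set V} {a b v : V} {l : Bool} {m : ℕ} {x x' : ℝ}
    (hmax : ∀ v' ∈ U, scoreC G W a b v' ≤ scoreC G W a b v)
    (hm : k ≤ m) (hWm : W.ncard ≤ m) (hUW : U ⊆ W) (ha : y a = l) (hb : y b = l)
    (hB : (U.ncard : ℝ) ≤ (1 - rate k) * m ∨ 3 * rate k * m ^ 2 ≤ scoreB G W a b)
    (hx : bound k m - 2 ≤ x) (hxx : x - 1 ≤ x') (hxx' : y v = l → x ≤ x') :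
    Budget G y k (next G ⟨U, .findC a b l W⟩ v (y v)) x' := by
  have hUU : ((U \ {v}).ncard : ℝ) ≤ U.ncard := by
    exact_mod_cast Set.ncard_le_ncard Set.sdiff_subset (Set.toFinite _)
  simp only [next]
  split_ifs with hl
  · exact Or.inr ⟨m, hm, hWm, Set.sdiff_subset.trans hUW, ha, hb, hB.imp_left hUU.trans,
      hx.trans (hxx' hl)⟩
  · refine budget_enterSweep hk hm ha hb (by cases l <;> simpa using hl) ?_
      (by linarith : bound k m - 3 ≤ x')
    set U' := U \ {v} with hU'
    rcases le_or_gt (U'.ncard : ℝ) ((1 - rate k) * m) with h | h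
    · refine le_trans ?_ h
      exact_mod_cast Set.ncard_le_ncard Set.sdiff_subset (Set.toFinite _)
    · have hr := rate_pos hk
      have hm0 : (0 : ℝ) < m := by exact_mod_cast (by omega : 0 < m)
      have hWm' : (W.ncard : ℝ) ≤ m := by exact_mod_cast hWm
      have hUm : (U.ncard : ℝ) ≤ m := by
        exact_mod_cast (Set.ncard_le_ncard hUW (Set.toFinite _)).trans hWm
      have hB' := hB.resolve_left (by linarith)
      have h1 : ((W \ U).ncard : ℝ) ≤ rate k * m := by rw [cast_ncard_sdiff hUW]; linarith
      have h2 : ((W \ U').ncard : ℝ) ≤ rate k * m := by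
        rw [cast_ncard_sdiff (Set.sdiff_subset.trans hUW)]; linarith
      have h3 : (scoreB G W a b : ℝ) ≤ U.ncard * scoreC G W a b v + (W \ U).ncard * W.ncard := by
        exact_mod_cast scoreB_le_of_scoreC_le hmax
      have h4 : (scoreC G W a b v : ℝ) ≤ (sweepSet G U' a b v).ncard + (W \ U').ncard := by
        exact_mod_cast scoreC_le_ncard_sweepSet_add U' W a b v
      have h5 : ((W \ U).ncard : ℝ) * W.ncard ≤ rate k * m * m := by gcongr
      have h6 : (U.ncard : ℝ) * scoreC G W a b v ≤ m * scoreC G W a b v := by gcongr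
      have h7 : 2 * rate k * m ≤ scoreC G W a b v := by
        refine le_of_mul_le_mul_left ?_ hm0
        linarith
      rw [cast_ncard_sdiff fun z hz => hz.1]
      linarith

/-- A wrong prediction would put a node of both geodesics into both convex clusters. -/
theorem budget_next_sweep (hk : 0 < k) (hy : y ∈ convexBipartitions G) {U : Set V}
    {a b c v : V} {l : Bool} {m : ℕ} {x : ℝ} (hv : v ∈ sweepSet G U a b c)
    (hm : k ≤ m) (ha : y a = l) (hb : y b = l) (hc : y c = !l)
    (hU : ((U \ sweepSet G U a b c).ncard : ℝ) ≤ (1 - rate k) * m) (hx : bound k m - 3 ≤ x) :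
    y v = l ∧ Budget G y k (next G ⟨U, .sweep a b c l⟩ v (y v)) x := by
  have hl : y v = l := by
    by_contra hl
    obtain ⟨-, -, z, hz, hz'⟩ := mem_goodQuads_iff.1 hv.2
    have h1 : y z = l := hy l a ha b hb hz
    have h2 : y z = !l := hy (!l) c hc v (by cases l <;> simpa using hl) hz'
    rw [h1] at h2
    simp at h2
  refine ⟨hl, ?_⟩
  simp only [next, if_pos hl]
  -- Labeling `v` removes no other node from the sweep, so the part left over by the sweep does not
  -- grow.
  refine budget_enterSweep hk hm ha hb hc (le_trans ?_ hU) hx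
  refine Nat.cast_le.2 (Set.ncard_le_ncard ?_ (Set.toFinite _))
  rintro z ⟨⟨hzU, hzv⟩, hz⟩
  refine ⟨hzU, fun hzs => hz ⟨⟨hzU, hzv⟩, ?_⟩⟩
  obtain ⟨-, hn, hI⟩ := mem_goodQuads_iff.1 hzs.2
  exact mem_goodQuads_iff.2 ⟨⟨by simp, by simp, by simp, Or.inl ⟨hzU, hzv⟩⟩, hn, hI⟩

theorem Budget.next (hk : 6 ≤ k)
    (hG : ∀ S : Finset V, S.card = k → (goodQuads G (S : Set V)).Nonempty)
    (hy : y ∈ convexBipartitions G) {s : State V} {v : V} {p : Bool} {x : ℝ}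
    (hA : Allowed G s v p) (h : Budget G y k s x) :
    Budget G y k (Good4.next G s v (y v)) (x - if p ≠ y v then 1 else 0) := by
  have hx1 : x - 1 ≤ x - if p ≠ y v then 1 else 0 := by split_ifs <;> linarith
  have hx0 : p = y v → x ≤ x - if p ≠ y v then 1 else 0 := fun h => by simp [h]
  generalize (x - if p ≠ y v then 1 else 0) = x' at hx0 hx1 ⊢
  obtain ⟨U, ph⟩ := s
  obtain ⟨hv, hA⟩ := hA
  have hv : v ∈ U := hv
  -- Once the budget covers all unlabeled nodes it keeps doing so: a trial uses up one node and
  -- costs at most one mistake.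
  by_cases hUx : (U.ncard : ℝ) ≤ x
  · left
    have h1 : (Good4.next G ⟨U, ph⟩ v (y v)).unknown = U \ {v} := by
      cases ph <;> rfl
    rw [h1, cast_ncard_sdiff (by simpa using hv), Set.ncard_singleton]
    push_cast
    linarith
  have h := h.resolve_left hUx
  cases ph with
  | main =>
    refine budget_next_main hk hG hx1 hv ?_ hA h
    -- With fewer than `k` nodes left, the summand `k` of `bound` already pays for all of them.
    by_contra hcon
    have h1 : (U.ncard : ℝ) ≤ k := by exact_mod_cast (not_le.1 hcon).le
    have h2 := le_bound (k := k) (by omega) U.ncard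
    exact hUx (by linarith [show bound k U.ncard ≤ x from h])
  | findB a l W =>
    obtain ⟨m, hm, hWm, hUW, haW, ha, hs, hx⟩ := h
    refine budget_next_findB (by omega) hv hA.1 hm hWm hUW haW ha hs hx hx1 fun hl => hx0 ?_
    rw [hA.2]
    cases l <;> simpa using hl
  | findC a b l W =>
    obtain ⟨m, hm, hWm, hUW, ha, hb, hs, hx⟩ := h
    exact budget_next_findC (by omega) hA.1 hm hWm hUW ha hb hs hx hx1
      fun hl => hx0 (hA.2.trans hl.symm)
  | sweep a b c l =>
    obtain ⟨m, hm, ha, hb, hc, hs, hx⟩ := h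
    -- Used twice: with `x` to learn that the prediction is correct, then with `x'`, which is now
    -- known to be at least `x`.
    have h1 := fun x' h => (budget_next_sweep (x := x') (by omega) hy hA.1 hm ha hb hc hs h)
    exact (h1 x' (hx.trans (hx0 (hA.2.trans (h1 x hx).1.symm)))).2

end Good4

/-- If every set of `k` nodes contains a good quadruple, then Good4 makes `O(k ^ 4 log n)`
mistakes. -/
theorem IsGood4.mistakes_le {V : Type*} [Fintype V] {G : SimpleGraph V} {k : ℕ} (hk : 6 ≤ k)
    (hG : ∀ S : Finset V, S.card = k → (goodQuads G (S : Set V)).Nonempty) {A : Learner V}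
    (hA : IsGood4 G A) {y : V → Bool} (hy : y ∈ convexBipartitions G) :
    (A.mistakes y : ℝ) ≤ Good4.bound k (Fintype.card V) := by
  have key : ∀ t ≤ Fintype.card V, Good4.Budget G y k (Good4.stateAfter G (A.run y t))
      (Good4.bound k (Fintype.card V) - ((Finset.range t).filter
        fun t => (A (A.run y t)).2 ≠ y (A (A.run y t)).1).card) := by
    intro t
    induction t with
    | zero =>
      intro _
      right
      simp [Learner.run, Good4.stateAfter, Set.ncard_univ]
    | succ t ih =>
      intro ht
      have h := (ih (by omega)).next hk hG hy (hA y t (by omega))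
      convert h using 1
      · rfl
      · rw [Finset.range_add_one, Finset.filter_insert]
        split_ifs with hp
        · rw [Finset.card_insert_of_notMem (by simp)]
          push_cast
          ring
        · simp
  have := (key _ le_rfl).nonneg (by omega)
  unfold Learner.mistakes
  linarith

theorem mainTheorem11 :
    ∃ C : ℝ, 0 < C ∧
      ∀ (V : Type*) [Fintype V] (G : SimpleGraph V), G.Connected → 2 ≤ Fintype.card V →
        (IsChordal G ∨ IsCircularArc G) →
        ∀ A : Learner V, IsGood4 G A →
          (mistakesSD A (convexBipartitions G) : ℝ) ≤
            C * (G.cliqueNum : ℝ) ^ 4 * Real.log (Fintype.card V) := by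
  -- With k = 10ω, `3 / rate k` is 240 · 10^4 · ω^4, and 10ω + 3 ≤ 13ω^4 ≤ 26ω^4 ln n because 2 ln 2
  -- ≥ 1.
  refine ⟨2400026, by norm_num, fun V _ G hconn hn hG A hA => ?_⟩
  set ω := G.cliqueNum with hω
  have hω1 : 1 ≤ ω := by
    obtain ⟨v⟩ := hconn.nonempty
    have h : G.IsClique ({v} : Finset V) := by simp
    simpa using SimpleGraph.IsClique.card_le_cliqueNum (tc := h)
  have hquad : ∀ S : Finset V, S.card = 10 * ω → (goodQuads G (S : Set V)).Nonempty := by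
    intro S hS
    rcases hG with hG | hG
    · exact hG.goodQuads_nonempty hconn (by omega)
    · exact hG.goodQuads_nonempty hconn (by omega)
  have hle : (mistakesSD A (convexBipartitions G) : ℝ) ≤
      Good4.bound (10 * ω) (Fintype.card V) := by
    have hb := Good4.le_bound (k := 10 * ω) (by omega) (Fintype.card V)
    -- Rounding down moves the bound into ℕ, where `csSup_le'` needs no nonemptiness.
    rw [← Nat.le_floor_iff ((by positivity : (0 : ℝ) ≤ ((10 * ω : ℕ) : ℝ) + 3).trans hb)]
    refine csSup_le' ?_
    rintro _ ⟨y, hy, rfl⟩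
    exact Nat.le_floor (hA.mistakes_le (by omega) hquad hy)
  refine hle.trans ?_
  have hω' : (1 : ℝ) ≤ ω := by exact_mod_cast hω1
  have hlog : 1 ≤ 2 * Real.log (Fintype.card V) := by
    have h1 : Real.log 2 ≤ Real.log (Fintype.card V) :=
      Real.log_le_log (by norm_num) (by exact_mod_cast hn)
    linarith [Real.log_two_gt_d9]
  have hpow : (ω : ℝ) ≤ (ω : ℝ) ^ 4 := le_self_pow₀ hω' (by norm_num)
  have h1 : Good4.bound (10 * ω) (Fintype.card V) =
      10 * ω + 3 + 2400000 * (ω : ℝ) ^ 4 * Real.log (Fintype.card V) := by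
    unfold Good4.bound Good4.rate
    push_cast
    field_simp
    ring
  have h2 : (10 * ω + 3 : ℝ) ≤ 13 * (ω : ℝ) ^ 4 := by linarith
  have h3 : 13 * (ω : ℝ) ^ 4 * 1 ≤ 13 * (ω : ℝ) ^ 4 * (2 * Real.log (Fintype.card V)) := by
    gcongr
  rw [h1]
  linarith
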